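/- For a word $w$ and a word $v$ over a finite alphabet $A$, let $|w|_v = \#\{(x,y)\in A^*\times A^* : x\,v\,y = w\}$ be the number of occurrences of $v$ in $w$ as a contiguous subword, and for $w_1,\dots,w_k\in A^*$ let $\mathrm{WMIX}(w_1,\dots,w_k)=\{w\in A^* : |w|_{w_1}=\cdots=|w|_{w_k}\}$. Then it is decidable, given a finite alphabet $A$ and words $w_1,\dots,w_k\in A^*$, whether $\mathrm{WMIX}(w_1,\dots,w_k)$ is infinite; that is, there is an algorithm which, on input $A$ and $w_1,\dots,w_k$, always halts and answers whether this language is infinite. -/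

import Mathlib

universe u

/-- The number `|w|_v` of occurrences of `v` as a contiguous factor of `w`: the number of pairs
`(w₁, w₂)` of words with `w₁ v w₂ = w`. In particular the empty word occurs `|w| + 1` times. -/
noncomputable def occ {A : Type*} (v w : List A) : ℕ :=
  {p : List A × List A | p.1 ++ v ++ p.2 = w}.ncard

/-- The Word-MIX language of the parameter words `ws = [w₁, …, w_k]`: all words `w` over `A` with
`|w|_{w₁} = ⋯ = |w|_{w_k}`. -/
def wmix {A : Type*} (ws : List (List A)) : Set (List A) :=
  {w | ∀ u ∈ ws, ∀ v ∈ ws, occ u w = occ v w}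

/-! Reading `w` from right to left, $|w|_u - |w|_v$ is, up to its value at the empty word, the total
weight of a run of a finite automaton that remembers a bounded window of letters (`occ_sub_occ`).
Membership in the language thus says that finitely many run totals take prescribed values.

A run decomposes into a skeleton of bounded length and short cycles based at states of the skeleton
(`exists_skeleton`); conversely, any family of such cycles can be inserted into the skeleton
(`exists_insert_cycles`). The weight vectors of the cycles are bounded and have a bounded sum, so if
the cycles are long enough in total, some nonempty subfamily of bounded total length sums to zero
(`Multiset.exists_zero_sum`). Deleting it shortens the word by a bounded amount, and repeating it
lengthens the word, within the language (`wmix_pumping`).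

Hence the language is infinite exactly when it has a word in an explicit finite range of lengths
(`wmix_infinite_iff`), and the search for one is primitive recursive. -/

/-! ### Zero-sum subfamilies of bounded integer vectors -/

theorem Multiset.abs_sum_map_le {α : Type u} (f : α → ℤ) (B : ℕ) (S : Multiset α)
    (h : ∀ x ∈ S, |f x| ≤ B) : |(S.map f).sum| ≤ S.card * B := by
  induction S using Multiset.induction with
  | empty => simp
  | cons a S ih =>
    have h1 := h a (by simp)
    have h2 := ih fun x hx => h x (by simp [hx])
    have h3 := abs_add_le (f a) (S.map f).sum
    simp only [Multiset.map_cons, Multiset.sum_cons, Multiset.card_cons]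
    push_cast
    linarith

theorem Multiset.sum_map_le_card_mul {α : Type u} (f : α → ℕ) (B : ℕ) (S : Multiset α)
    (h : ∀ x ∈ S, f x ≤ B) : (S.map f).sum ≤ S.card * B := by
  induction S using Multiset.induction with
  | empty => simp
  | cons a S ih =>
    have h1 := h a (by simp)
    have h2 := ih fun x hx => h x (by simp [hx])
    simp only [Multiset.map_cons, Multiset.sum_cons, Multiset.card_cons]
    linarith

theorem Multiset.card_le_sum_map {α : Type u} (f : α → ℤ) (S : Multiset α)
    (h : ∀ x ∈ S, 0 < f x) : (S.card : ℤ) ≤ (S.map f).sum := by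
  induction S using Multiset.induction with
  | empty => simp
  | cons a S ih =>
    have h1 := h a (by simp)
    have h2 := ih fun x hx => h x (by simp [hx])
    simp only [Multiset.map_cons, Multiset.sum_cons, Multiset.card_cons]
    push_cast
    linarith

/-- Pigeonhole: among more than `B * B` items with values in `1, …, B`, some value is taken by
more than `B` of them. -/
theorem Multiset.exists_large_fiber {α : Type u} (f : α → ℤ) (B : ℕ) (S : Multiset α)
    (h : ∀ x ∈ S, 0 < f x ∧ f x ≤ B) (hS : B * B < S.card) :
    ∃ v : ℕ, 0 < v ∧ v ≤ B ∧ B ≤ (S.filter fun x => f x = v).card := by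
  by_contra! hcon
  have h1 : (S.map f).toFinset ⊆ Finset.Icc 1 (B : ℤ) := by
    intro v hv
    simp only [Multiset.mem_toFinset, Multiset.mem_map] at hv
    obtain ⟨x, hx, rfl⟩ := hv
    have := h x hx
    simp only [Finset.mem_Icc]
    omega
  have h2 : (S.map f).card = ∑ v ∈ Finset.Icc 1 (B : ℤ), (S.map f).count v :=
    (Multiset.sum_count_eq_card fun v hv => h1 (by simpa using hv)).symm
  have h3 : ∑ v ∈ Finset.Icc 1 (B : ℤ), (S.map f).count v ≤
      (Finset.Icc 1 (B : ℤ)).card * B := by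
    rw [← smul_eq_mul]
    refine Finset.sum_le_card_nsmul _ _ _ fun v hv => ?_
    simp only [Finset.mem_Icc] at hv
    have := hcon v.toNat (by omega) (by omega)
    rw [Multiset.count_map]
    have e : ((v.toNat : ℕ) : ℤ) = v := by omega
    rw [e] at this
    simp only [eq_comm] at this ⊢
    omega
  simp at h2 h3
  omega

theorem Multiset.exists_le_and_card_eq {α : Type u} {n : ℕ} {S : Multiset α} (h : n ≤ S.card) :
    ∃ T ≤ S, T.card = n := by
  have : 0 < (Multiset.powersetCard n S).card := by
    rw [Multiset.card_powersetCard]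
    exact Nat.choose_pos h
  obtain ⟨T, hT⟩ := Multiset.card_pos_iff_exists_mem.1 this
  exact ⟨T, Multiset.mem_powersetCard.1 hT⟩

/-- The sum of a function that is constant on a multiset. -/
theorem Multiset.sum_map_of_forall_eq {α : Type u} (f : α → ℤ) (v : ℤ) (S : Multiset α)
    (h : ∀ x ∈ S, f x = v) : (S.map f).sum = S.card * v := by
  rw [Multiset.map_congr rfl h]
  simp

/-- Many bounded integers with a bounded sum have a short nonempty zero-sum subfamily. -/
theorem Multiset.exists_zero_sum_block {α : Type u} (f : α → ℤ) (B : ℕ) (S : Multiset α)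
    (hf : ∀ x ∈ S, |f x| ≤ B) (hsum : |(S.map f).sum| ≤ B)
    (hS : B * B * B + B * B + B < S.card) :
    ∃ U ≤ S, U ≠ 0 ∧ U.card ≤ 2 * B + 1 ∧ (U.map f).sum = 0 := by
  classical
  by_cases hz : ∃ x ∈ S, f x = 0
  · obtain ⟨x, hx, h0⟩ := hz
    exact ⟨{x}, by simpa using hx, by simp, by simp, by simpa using h0⟩
  push Not at hz
  set P := S.filter fun x => 0 < f x with hP
  set N := S.filter fun x => ¬ 0 < f x with hN
  have hPN : P + N = S := Multiset.filter_add_not _ _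
  have hPpos : ∀ x ∈ P, 0 < f x ∧ f x ≤ B := fun x hx => by
    obtain ⟨hx, hx'⟩ := Multiset.mem_filter.1 hx
    exact ⟨hx', (abs_le.1 (hf x hx)).2⟩
  have hNpos : ∀ x ∈ N, 0 < (-f x) ∧ (-f x) ≤ B := fun x hx => by
    obtain ⟨hx, hx'⟩ := Multiset.mem_filter.1 hx
    have := (abs_le.1 (hf x hx)).1
    have := hz x hx
    omega
  have hPsum := Multiset.card_le_sum_map f P fun x hx => (hPpos x hx).1
  have hNsum := Multiset.card_le_sum_map (fun x => -f x) N fun x hx => (hNpos x hx).1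
  have hPabs := Multiset.abs_sum_map_le f B P fun x hx => by
    have := hPpos x hx; rw [abs_le]; omega
  have hNabs := Multiset.abs_sum_map_le f B N fun x hx => by
    have := hNpos x hx; rw [abs_le]; omega
  simp only [Multiset.sum_map_neg] at hNsum
  have hadd : (S.map f).sum = (P.map f).sum + (N.map f).sum := by
    rw [← hPN, Multiset.map_add, Multiset.sum_add]
  have hcard : S.card = P.card + N.card := by rw [← hPN, Multiset.card_add]
  rw [hadd, abs_le] at hsum
  rw [abs_le] at hPabs hNabs
  -- If one sign had at most `B²` members, its sum would be at most `B³` in absolute value and that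
  -- of the other sign at most `B³ + B`. Nonzero integers count at least 1 each, so `S` would have
  -- at most `B³ + B² + B` members.
  have hNbig : B * B < N.card := by
    by_contra! hlt
    have h1 : (N.card : ℤ) * B ≤ B * B * B := by
      have : N.card * B ≤ B * B * B := Nat.mul_le_mul_right _ hlt
      exact_mod_cast this
    have : (B * B * B + B * B + B : ℤ) < P.card + N.card := by rw [hcard] at hS; exact_mod_cast hS
    have : (N.card : ℤ) ≤ B * B := by exact_mod_cast hlt
    linarith [hsum.2, hNabs.1]
  have hPbig : B * B < P.card := by
    by_contra! hlt
    have h1 : (P.card : ℤ) * B ≤ B * B * B := by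
      have : P.card * B ≤ B * B * B := Nat.mul_le_mul_right _ hlt
      exact_mod_cast this
    have : (B * B * B + B * B + B : ℤ) < P.card + N.card := by rw [hcard] at hS; exact_mod_cast hS
    have : (P.card : ℤ) ≤ B * B := by exact_mod_cast hlt
    linarith [hsum.1, hPabs.2]
  obtain ⟨p, hp, hpB, hpc⟩ := Multiset.exists_large_fiber f B P hPpos hPbig
  obtain ⟨n, hn, hnB, hnc⟩ := Multiset.exists_large_fiber (fun x => -f x) B N hNpos hNbig
  obtain ⟨U, hU, hUc⟩ := Multiset.exists_le_and_card_eq (hnB.trans hpc)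
  obtain ⟨V, hV, hVc⟩ := Multiset.exists_le_and_card_eq (hpB.trans hnc)
  -- `U` has `n` items of value `p`, and `V` has `p` items of value `-n`.
  refine ⟨U + V, ?_, ?_, ?_, ?_⟩
  · rw [← hPN]
    exact add_le_add (hU.trans (Multiset.filter_le _ _)) (hV.trans (Multiset.filter_le _ _))
  · rw [← Multiset.card_pos, Multiset.card_add]
    omega
  · rw [Multiset.card_add]
    omega
  · have h1 := Multiset.sum_map_of_forall_eq f p U fun x hx =>
      (Multiset.mem_filter.1 (Multiset.mem_of_le hU hx)).2
    have h2 := Multiset.sum_map_of_forall_eq f (-n) V fun x hx => by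
      have := (Multiset.mem_filter.1 (Multiset.mem_of_le hV hx)).2
      omega
    rw [Multiset.map_add, Multiset.sum_add, h1, h2, hUc, hVc]
    ring

/-- Bounded integers with a bounded sum split into short zero-sum blocks and a small remainder. -/
theorem Multiset.exists_zero_sum_blocks {α : Type u} (f : α → ℤ) (B : ℕ) (S : Multiset α)
    (hf : ∀ x ∈ S, |f x| ≤ B) (hsum : |(S.map f).sum| ≤ B) :
    ∃ (P : Multiset (Multiset α)) (R : Multiset α), P.join + R = S ∧
      R.card ≤ B * B * B + B * B + B ∧
      ∀ U ∈ P, U ≠ 0 ∧ U.card ≤ 2 * B + 1 ∧ (U.map f).sum = 0 := by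
  induction hc : S.card using Nat.strong_induction_on generalizing S with
  | _ c ih =>
    by_cases hS : S.card ≤ B * B * B + B * B + B
    · exact ⟨0, S, by simp, hS, by simp⟩
    obtain ⟨U, hU, hU0, hUc, hUs⟩ :=
      Multiset.exists_zero_sum_block f B S hf hsum (not_le.1 hS)
    obtain ⟨V, rfl⟩ := Multiset.le_iff_exists_add.1 hU
    have hpos := Multiset.card_pos.2 hU0
    rw [Multiset.map_add, Multiset.sum_add, hUs, zero_add] at hsum
    obtain ⟨P, R, hPR, hR, hP⟩ := ih V.card (by rw [← hc, Multiset.card_add]; omega) V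
      (fun x hx => hf x (Multiset.mem_add.2 (Or.inr hx))) hsum rfl
    refine ⟨U ::ₘ P, R, by rw [Multiset.join_cons, add_assoc, hPR], hR, fun W hW => ?_⟩
    rcases Multiset.mem_cons.1 hW with rfl | hW
    · exact ⟨hU0, hUc, hUs⟩
    · exact hP W hW

/-- The growth of the zero-sum bound with each further coordinate. -/
def zeroSumStep (B : ℕ) : ℕ :=
  B + (B * B * B + B * B + B) * B + (2 * B + 1) * B + (B * B * B + B * B + B) * B

theorem zeroSumStep_add_le (x y : ℕ) : zeroSumStep x + y ≤ zeroSumStep (x + y) := by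
  unfold zeroSumStep
  have : x ≤ x + y := Nat.le_add_right x y
  have h1 : (x * x * x + x * x + x) * x ≤
      ((x + y) * (x + y) * (x + y) + (x + y) * (x + y) + (x + y)) * (x + y) := by gcongr
  have h2 : (2 * x + 1) * x ≤ (2 * (x + y) + 1) * (x + y) := by gcongr
  omega

/-- Each step grows at least as fast as its argument. This lets the size lost to a remainder be paid
for inside the iterated bound. -/
theorem zeroSumStep_iterate_add_le (d x y : ℕ) :
    zeroSumStep^[d] x + y ≤ zeroSumStep^[d] (x + y) := by
  induction d generalizing x y with
  | zero => simp
  | succ d ih =>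
    rw [Function.iterate_succ_apply, Function.iterate_succ_apply]
    obtain ⟨z, hz⟩ := Nat.exists_eq_add_of_le (zeroSumStep_add_le x y)
    rw [hz, add_assoc]
    have := ih (zeroSumStep x) (y + z)
    omega

theorem Multiset.sum_map_join {α : Type u} {β : Type*} [AddCommMonoid β] (f : α → β)
    (P : Multiset (Multiset α)) :
    (P.map fun U => (U.map f).sum).sum = (P.join.map f).sum := by
  induction P using Multiset.induction with
  | empty => simp
  | cons U P ih =>
    rw [Multiset.map_cons, Multiset.sum_cons, ih, Multiset.join_cons, Multiset.map_add,
      Multiset.sum_add]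

/-- Many bounded integer vectors with a bounded sum have a small nonempty zero-sum subfamily. -/
theorem Multiset.exists_zero_sum (d : ℕ) {α : Type u} (B : ℕ) (f : ℕ → α → ℤ) (size : α → ℕ)
    (S : Multiset α) (hsize : ∀ x ∈ S, size x ≤ B) (hf : ∀ x ∈ S, ∀ j < d, |f j x| ≤ B)
    (hsum : ∀ j < d, |(S.map (f j)).sum| ≤ B) (hS : zeroSumStep^[d] B < (S.map size).sum) :
    ∃ T ≤ S, T ≠ 0 ∧ (T.map size).sum ≤ zeroSumStep^[d] B ∧
      ∀ j < d, (T.map (f j)).sum = 0 := by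
  induction d generalizing α B with
  | zero =>
    obtain ⟨x, hx⟩ : ∃ x, x ∈ S := by
      refine Multiset.exists_mem_of_ne_zero ?_
      rintro rfl
      simp at hS
    exact ⟨{x}, by simpa using hx, by simp, by simpa using hsize x hx, by simp⟩
  | succ d ih =>
    obtain ⟨P, R, rfl, hR, hP⟩ := Multiset.exists_zero_sum_blocks (f d) B S
      (fun x hx => hf x hx d (Nat.lt_succ_self d)) (hsum d (Nat.lt_succ_self d))
    set t := B * B * B + B * B + B with ht
    -- The blocks, already zero-sum in coordinate `d`, become the items for the remaining
    -- coordinates. The term `(2 * B + 1) * B` bounds the size and coordinates of one block, and `B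
    -- + t * B` the sum over all blocks, which omits the remainder `R`. The further `t * B` in
    -- `zeroSumStep` pays for the size of `R`.
    set B' := B + t * B + (2 * B + 1) * B with hB'
    have hstep : zeroSumStep B = B' + t * B := rfl
    have hmem : ∀ U ∈ P, ∀ x ∈ U, x ∈ P.join + R := fun U hU x hx =>
      Multiset.mem_add.2 (Or.inl (Multiset.mem_join.2 ⟨U, hU, hx⟩))
    have hmemR : ∀ x ∈ R, x ∈ P.join + R := fun x hx => Multiset.mem_add.2 (Or.inr hx)
    have hRB : R.card * B ≤ t * B := Nat.mul_le_mul_right _ hR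
    rw [Function.iterate_succ_apply, hstep] at hS ⊢
    have hadd := zeroSumStep_iterate_add_le d B' (t * B)
    obtain ⟨T, hT, hT0, hTs, hTf⟩ := ih B' (fun j U => (U.map (f j)).sum)
      (fun U => (U.map size).sum) P
      (fun U hU => by
        have h1 := Multiset.sum_map_le_card_mul size B U fun x hx => hsize x (hmem U hU x hx)
        have h2 : U.card * B ≤ (2 * B + 1) * B := Nat.mul_le_mul_right _ (hP U hU).2.1
        change (U.map size).sum ≤ B'
        omega)
      (fun U hU j hj => by
        have h1 := Multiset.abs_sum_map_le (f j) B U fun x hx => hf x (hmem U hU x hx) j (by omega)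
        have h2 : U.card * B ≤ (2 * B + 1) * B := Nat.mul_le_mul_right _ (hP U hU).2.1
        have h3 : ((U.card * B : ℕ) : ℤ) ≤ (B' : ℕ) := by
          exact_mod_cast (by omega : U.card * B ≤ B')
        push_cast at h3
        exact h1.trans h3)
      (fun j hj => by
        rw [Multiset.sum_map_join]
        have h1 := Multiset.abs_sum_map_le (f j) B R fun x hx => hf x (hmemR x hx) j (by omega)
        have h2 := hsum j (by omega)
        rw [Multiset.map_add, Multiset.sum_add] at h2
        have h3 : ((B + R.card * B : ℕ) : ℤ) ≤ (B' : ℕ) := by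
          exact_mod_cast (by omega : B + R.card * B ≤ B')
        push_cast at h3
        rw [abs_le] at *
        constructor <;> linarith [h1.1, h1.2, h2.1, h2.2])
      (by
        rw [Multiset.sum_map_join]
        rw [Multiset.map_add, Multiset.sum_add] at hS
        have h1 := Multiset.sum_map_le_card_mul size B R fun x hx => hsize x (hmemR x hx)
        omega)
    refine ⟨T.join, ?_, ?_, ?_, fun j hj => ?_⟩
    · obtain ⟨T', rfl⟩ := Multiset.le_iff_exists_add.1 hT
      rw [Multiset.join_add, add_assoc]
      exact Multiset.le_add_right _ _
    · obtain ⟨U, hU⟩ := Multiset.exists_mem_of_ne_zero hT0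
      obtain ⟨x, hx⟩ := Multiset.exists_mem_of_ne_zero (hP U (Multiset.mem_of_le hT hU)).1
      intro h0
      have : x ∈ T.join := Multiset.mem_join.2 ⟨U, hU, hx⟩
      rw [h0] at this
      simp at this
    · rw [← Multiset.sum_map_join]
      omega
    · rw [← Multiset.sum_map_join]
      rcases Nat.lt_succ_iff_lt_or_eq.1 hj with hj | rfl
      · exact hTf j hj
      · exact Multiset.sum_eq_zero fun z hz => by
          obtain ⟨U, hU, rfl⟩ := Multiset.mem_map.1 hz
          exact (hP U (Multiset.mem_of_le hT hU)).2.2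

/-! ### Weighted runs of finite automata and their cycles -/

/-- The total weight of the letters of a word read from the state `s`. -/
def runWeight {Q A : Type*} (δ : Q → A → Q) (g : Q → A → ℤ) : Q → List A → ℤ
  | _, [] => 0
  | s, a :: w => g s a + runWeight δ g (δ s a) w

/-- A run from `s` on some prefix of `w` ends in `p`. -/
def Visits {Q A : Type*} (δ : Q → A → Q) (s : Q) (w : List A) (p : Q) : Prop :=
  ∃ x, x <+: w ∧ x.foldl δ s = p

section Automaton

variable {Q A : Type u} (δ : Q → A → Q)

theorem runWeight_append (g : Q → A → ℤ) (s : Q) (x y : List A) :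
    runWeight δ g s (x ++ y) = runWeight δ g s x + runWeight δ g (x.foldl δ s) y := by
  induction x generalizing s with
  | nil => simp [runWeight]
  | cons a x ih => simp [runWeight, ih, add_assoc]

theorem abs_runWeight_le (g : Q → A → ℤ) (hg : ∀ q a, |g q a| ≤ 1) (s : Q) (w : List A) :
    |runWeight δ g s w| ≤ w.length := by
  induction w generalizing s with
  | nil => simp [runWeight]
  | cons a w ih =>
    have h1 := abs_add_le (g s a) (runWeight δ g (δ s a) w)
    have h2 := ih (δ s a)
    have h3 := hg s a
    simp only [runWeight, List.length_cons]
    push_cast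
    linarith

variable {δ}

theorem Visits.append_left {s p : Q} {w : List A} (h : Visits δ s w p) (v : List A) :
    Visits δ s (w ++ v) p := by
  obtain ⟨x, hx, rfl⟩ := h
  exact ⟨x, hx.trans (List.prefix_append _ _), rfl⟩

theorem Visits.append_right {s p : Q} {u w : List A} (h : Visits δ (u.foldl δ s) w p) :
    Visits δ s (u ++ w) p := by
  obtain ⟨x, hx, rfl⟩ := h
  exact ⟨u ++ x, (List.prefix_append_right_inj u).2 hx, by simp⟩

theorem visits_append_iff {s p : Q} {u w : List A} :
    Visits δ s (u ++ w) p ↔ Visits δ s u p ∨ Visits δ (u.foldl δ s) w p := by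
  constructor
  · rintro ⟨x, hx, rfl⟩
    rcases List.prefix_or_prefix_of_prefix hx (List.prefix_append u w) with h | ⟨y, rfl⟩
    · exact Or.inl ⟨x, h, rfl⟩
    · exact Or.inr ⟨y, (List.prefix_append_right_inj u).1 hx, by simp⟩
  · rintro (h | h)
    · exact h.append_left w
    · exact h.append_right

variable (δ)

/-- A run of length the number of states contains a cycle. -/
theorem exists_cycle [Fintype Q] (s : Q) (w : List A) (hw : w.length = Fintype.card Q) :
    ∃ a y b, w = a ++ y ++ b ∧ y ≠ [] ∧ y.foldl δ (a.foldl δ s) = a.foldl δ s := by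
  obtain ⟨i, j, hij, h⟩ := Fintype.exists_ne_map_eq_of_card_lt
    (fun i : Fin (Fintype.card Q + 1) => (w.take i).foldl δ s) (by simp)
  wlog hlt : i < j generalizing i j
  · exact this j i hij.symm h.symm (lt_of_le_of_ne (not_lt.1 hlt) hij.symm)
  have hlt' : (i : ℕ) < j := hlt
  have hj := j.2
  have hsplit : w.take i ++ (w.take j).drop i = w.take j := by
    conv_rhs => rw [← List.take_append_drop i (w.take j), List.take_take, min_eq_left hlt'.le]
  refine ⟨w.take i, (w.take j).drop i, w.drop j, ?_, ?_, ?_⟩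
  · rw [hsplit, List.take_append_drop]
  · rw [← List.length_pos_iff]
    simp
    omega
  · rw [← List.foldl_append, hsplit]
    exact h.symm

/-- A run decomposes into a short run and short cycles based at states of the short run
(or of the given set `U`). -/
theorem exists_skeleton [Fintype Q] (s : Q) (w : List A) (U : Finset Q) :
    ∃ (x : List A) (C : Multiset (Q × List A)),
      x.length + Fintype.card Q * U.card ≤ Fintype.card Q * (Fintype.card Q + 1) ∧
      (∀ c ∈ C, c.2 ≠ [] ∧ c.2.length ≤ Fintype.card Q ∧ c.2.foldl δ c.1 = c.1 ∧
        (Visits δ s x c.1 ∨ c.1 ∈ U)) ∧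
      w.length = x.length + (C.map fun c => c.2.length).sum ∧
      ∀ g : Q → A → ℤ, runWeight δ g s w =
        runWeight δ g s x + (C.map fun c => runWeight δ g c.1 c.2).sum := by
  classical
  induction hn : w.length using Nat.strong_induction_on generalizing s w U with
  | _ n ih =>
    have hq : 0 < Fintype.card Q := Fintype.card_pos_iff.2 ⟨s⟩
    by_cases hw : w.length ≤ Fintype.card Q
    · refine ⟨w, 0, ?_, by simp, by simp [hn], by simp⟩
      have : Fintype.card Q * U.card ≤ Fintype.card Q * Fintype.card Q :=
        Nat.mul_le_mul_left _ (Finset.card_le_univ U)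
      rw [mul_add, mul_one]
      omega
    push Not at hw
    obtain ⟨u, v, rfl, hu⟩ : ∃ u v, w = u ++ v ∧ u.length = Fintype.card Q :=
      ⟨w.take (Fintype.card Q), w.drop (Fintype.card Q), (List.take_append_drop _ _).symm,
        by simp; omega⟩
    rw [List.length_append] at hn
    -- If `u` meets no state outside `U`, a cycle in it is based in `U` and can be cut out.
    -- Otherwise `u` is kept in the skeleton and its states join `U`; this happens at most once per
    -- state, which bounds the skeleton.
    by_cases hU : ∀ p, Visits δ s u p → p ∈ U
    · obtain ⟨a, y, b, rfl, hy, hcyc⟩ := exists_cycle δ s u hu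
      have hypos := List.length_pos_iff.2 hy
      simp only [List.length_append] at hn hu
      obtain ⟨x, C, hx, hC, hlen, hwt⟩ := ih (a ++ (b ++ v)).length
        (by simp only [List.length_append]; omega) s (a ++ (b ++ v)) U rfl
      refine ⟨x, (a.foldl δ s, y) ::ₘ C, hx, ?_, ?_, fun g => ?_⟩
      · intro c hc
        rcases Multiset.mem_cons.1 hc with rfl | hc
        · exact ⟨hy, by simp only; omega, hcyc, Or.inr (hU _ ⟨a, by simp, rfl⟩)⟩
        · exact hC c hc
      · simp only [List.length_append, Multiset.map_cons, Multiset.sum_cons] at hlen ⊢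
        omega
      · have h := hwt g
        rw [runWeight_append] at h
        rw [List.append_assoc, List.append_assoc, runWeight_append, runWeight_append, hcyc]
        simp only [Multiset.map_cons, Multiset.sum_cons]
        linarith
    · push Not at hU
      obtain ⟨p, hp, hpU⟩ := hU
      set U' := Finset.univ.filter fun p => Visits δ s u p ∨ p ∈ U with hU'
      have hcard : U.card < U'.card := by
        refine Finset.card_lt_card ⟨fun r hr => by simp [hU', hr], fun hsub => hpU (hsub ?_)⟩
        simp [hU', hp]
      obtain ⟨x, C, hx, hC, hlen, hwt⟩ := ih v.length (by omega) (u.foldl δ s) v U' rfl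
      refine ⟨u ++ x, C, ?_, fun c hc => ?_, ?_, fun g => ?_⟩
      · have : Fintype.card Q * (U.card + 1) ≤ Fintype.card Q * U'.card :=
          Nat.mul_le_mul_left _ hcard
        rw [mul_add, mul_one] at this
        rw [List.length_append]
        omega
      · obtain ⟨h1, h2, h3, h4⟩ := hC c hc
        refine ⟨h1, h2, h3, ?_⟩
        rw [visits_append_iff]
        simp only [hU', Finset.mem_filter, Finset.mem_univ, true_and] at h4
        tauto
      · rw [List.length_append]
        omega
      · rw [runWeight_append, runWeight_append, hwt g, add_assoc]

/-- Cycles based at visited states can be inserted into a run. -/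
theorem exists_insert_cycles (s : Q) (x : List A) (C : Multiset (Q × List A))
    (hC : ∀ c ∈ C, c.2.foldl δ c.1 = c.1 ∧ Visits δ s x c.1) :
    ∃ w : List A, (∀ p, Visits δ s x p → Visits δ s w p) ∧
      w.length = x.length + (C.map fun c => c.2.length).sum ∧
      ∀ g : Q → A → ℤ, runWeight δ g s w =
        runWeight δ g s x + (C.map fun c => runWeight δ g c.1 c.2).sum := by
  induction C using Multiset.induction with
  | empty => exact ⟨x, fun _ h => h, by simp, by simp⟩
  | cons c C ih =>
    obtain ⟨w, hv, hlen, hwt⟩ := ih fun c hc => hC c (Multiset.mem_cons_of_mem hc)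
    obtain ⟨hcyc, hvis⟩ := hC c (Multiset.mem_cons_self c C)
    obtain ⟨a, ⟨b, rfl⟩, hab⟩ := hv _ hvis
    -- Splicing a cycle in at a visit of its base loses no visited state, so the other cycles still
    -- fit.
    refine ⟨a ++ (c.2 ++ b), fun p hp => ?_, ?_, fun g => ?_⟩
    · have := hv p hp
      rw [visits_append_iff] at this ⊢
      rw [visits_append_iff, hab, hcyc]
      rw [hab] at this
      tauto
    · simp only [List.length_append, Multiset.map_cons, Multiset.sum_cons] at hlen ⊢
      omega
    · have h := hwt g
      rw [runWeight_append, hab] at h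
      rw [runWeight_append, runWeight_append, hab, hcyc]
      simp only [Multiset.map_cons, Multiset.sum_cons]
      linarith

/-- Pumping for languages of words whose runs have prescribed total weights. -/
theorem exists_shorter_and_longer [Fintype Q] (s : Q) (d B : ℕ) (g : ℕ → Q → A → ℤ)
    (k : ℕ → ℤ) (hg : ∀ j q a, |g j q a| ≤ 1) (hk : ∀ j, |k j| ≤ 1)
    (hB : Fintype.card Q * (Fintype.card Q + 1) + 1 ≤ B) (w : List A)
    (hw : ∀ j < d, k j + runWeight δ (g j) s w = 0)
    (hlen : zeroSumStep^[d] B + B < w.length) :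
    (∃ w' : List A, (∀ j < d, k j + runWeight δ (g j) s w' = 0) ∧ w'.length < w.length ∧
      w.length ≤ w'.length + zeroSumStep^[d] B) ∧
    ∃ w' : List A, (∀ j < d, k j + runWeight δ (g j) s w' = 0) ∧ w.length < w'.length := by
  obtain ⟨x, C, hx, hC, hl, hwt⟩ := exists_skeleton δ s w ∅
  simp only [Finset.card_empty, mul_zero, add_zero, Finset.notMem_empty, or_false] at hx hC
  have hqB : Fintype.card Q ≤ B := by nlinarith
  obtain ⟨T, hT, hT0, hTs, hTf⟩ := Multiset.exists_zero_sum d B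
    (fun j c => runWeight δ (g j) c.1 c.2) (fun c => c.2.length) C
    (fun c hc => (hC c hc).2.1.trans hqB)
    (fun c hc j _ => (abs_runWeight_le δ (g j) (hg j) c.1 c.2).trans
      (by exact_mod_cast (hC c hc).2.1.trans hqB))
    (fun j hj => by
      have h1 := hw j hj
      rw [hwt] at h1
      have h2 := abs_runWeight_le δ (g j) (hg j) s x
      have h3 := hk j
      -- The extra 1 in the bound on `B` absorbs the constant `k j`.
      have h4 : (x.length : ℤ) + 1 ≤ B := by exact_mod_cast (by omega)
      rw [abs_le] at *
      constructor <;> linarith [h2.1, h2.2, h3.1, h3.2])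
    (by omega)
  obtain ⟨T', rfl⟩ := Multiset.le_iff_exists_add.1 hT
  have hTpos : 0 < (T.map fun c => c.2.length).sum := by
    obtain ⟨c, hc⟩ := Multiset.exists_mem_of_ne_zero hT0
    obtain ⟨T₁, rfl⟩ := Multiset.exists_cons_of_mem hc
    have := List.length_pos_iff.2 (hC c (by simp)).1
    simp only [Multiset.map_cons, Multiset.sum_cons]
    omega
  have hC' : ∀ c ∈ T + T', c.2.foldl δ c.1 = c.1 ∧ Visits δ s x c.1 := fun c hc =>
    ⟨(hC c hc).2.2.1, (hC c hc).2.2.2⟩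
  simp only [Multiset.map_add, Multiset.sum_add] at hl hwt
  constructor
  · obtain ⟨w', -, hl', hwt'⟩ := exists_insert_cycles δ s x T' fun c hc =>
      hC' c (Multiset.mem_add.2 (Or.inr hc))
    refine ⟨w', fun j hj => ?_, by omega, by omega⟩
    have h1 := hw j hj
    rw [hwt, hTf j hj] at h1
    rw [hwt']
    linarith
  -- The zero-sum family `T` is inserted twice.
  · obtain ⟨w', -, hl', hwt'⟩ := exists_insert_cycles δ s x (T + (T + T')) fun c hc => by
      rcases Multiset.mem_add.1 hc with hc | hc
      · exact hC' c (Multiset.mem_add.2 (Or.inl hc))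
      · exact hC' c hc
    simp only [Multiset.map_add, Multiset.sum_add] at hl' hwt'
    refine ⟨w', fun j hj => ?_, by omega⟩
    have h1 := hw j hj
    rw [hwt, hTf j hj] at h1
    rw [hwt', hTf j hj]
    linarith

end Automaton

/-! ### Recursion for the number of occurrences -/

theorem occ_set_cons {A : Type*} (v w : List A) (a : A) :
    {p : List A × List A | p.1 ++ v ++ p.2 = a :: w} =
      {p | p.1 = [] ∧ v ++ p.2 = a :: w} ∪
        (fun p : List A × List A => (a :: p.1, p.2)) '' {p | p.1 ++ v ++ p.2 = w} := by
  ext ⟨x, y⟩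
  cases x with
  | nil => simp
  | cons b x =>
    simp only [List.cons_append, List.cons.injEq, Set.mem_ofPred_eq, Set.mem_union, reduceCtorEq,
      false_and, Set.mem_image, Prod.mk.injEq, Prod.exists, false_or]
    constructor
    · rintro ⟨rfl, h⟩
      exact ⟨x, y, h, ⟨rfl, rfl⟩, rfl⟩
    · rintro ⟨_, _, h, ⟨rfl, rfl⟩, rfl⟩
      exact ⟨rfl, h⟩

theorem subsingleton_prefix_occ {A : Type*} (v w : List A) :
    {p : List A × List A | p.1 = [] ∧ v ++ p.2 = w}.Subsingleton := by
  rintro ⟨x, y⟩ ⟨rfl, h⟩ ⟨x', y'⟩ ⟨rfl, h'⟩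
  simpa using h.trans h'.symm

theorem finite_occ_set {A : Type*} (v w : List A) :
    {p : List A × List A | p.1 ++ v ++ p.2 = w}.Finite := by
  induction w with
  | nil =>
    refine Set.Finite.subset (Set.finite_singleton ([], [])) ?_
    rintro ⟨x, y⟩ h
    simp_all
  | cons a w ih =>
    rw [occ_set_cons]
    exact (subsingleton_prefix_occ _ _).finite.union (ih.image _)

theorem ncard_prefix_occ {A : Type*} [DecidableEq A] (v w : List A) :
    {p : List A × List A | p.1 = [] ∧ v ++ p.2 = w}.ncard = if v <+: w then 1 else 0 := by
  split_ifs with h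
  · obtain ⟨y, hy⟩ := h
    rw [Set.ncard_eq_one]
    exact ⟨([], y), (subsingleton_prefix_occ v w).eq_singleton_of_mem ⟨rfl, hy⟩⟩
  · convert Set.ncard_empty (List A × List A)
    ext ⟨x, y⟩
    simp only [Set.mem_ofPred_eq, Set.mem_empty_iff_false, iff_false, not_and]
    exact fun _ hy => h ⟨y, hy⟩

theorem occ_nil {A : Type*} [DecidableEq A] (v : List A) :
    occ v [] = if v = [] then 1 else 0 := by
  have := ncard_prefix_occ v ([] : List A)
  simp only [List.prefix_nil] at this
  rw [← this, occ]
  congr 1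
  ext ⟨x, y⟩
  simp

theorem occ_cons {A : Type*} [DecidableEq A] (v w : List A) (a : A) :
    occ v (a :: w) = occ v w + if v <+: a :: w then 1 else 0 := by
  have hinj : Function.Injective fun p : List A × List A => (a :: p.1, p.2) := by
    rintro ⟨x, y⟩ ⟨x', y'⟩ h
    simpa using h
  have hdisj : Disjoint {p : List A × List A | p.1 = [] ∧ v ++ p.2 = a :: w}
      ((fun p : List A × List A => (a :: p.1, p.2)) '' {p | p.1 ++ v ++ p.2 = w}) := by
    rw [Set.disjoint_left]
    rintro _ ⟨h, -⟩ ⟨p, -, rfl⟩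
    simp at h
  rw [occ, occ_set_cons, Set.ncard_union_eq hdisj (subsingleton_prefix_occ _ _).finite
    ((finite_occ_set v w).image _), ncard_prefix_occ, Set.ncard_image_of_injective _ hinj, occ,
    add_comm]

/-! ### The window automaton -/

section Window

variable {A : Type u}

/-- Reading the letter `a` in front of a word whose first `M` letters are remembered. -/
def windowStep (M : ℕ) (q : {l : List A // l.length ≤ M}) (a : A) :
    {l : List A // l.length ≤ M} :=
  ⟨(a :: q.1).take M, List.length_take_le _ _⟩

/-- The change of `|w|_u - |w|_v` when a letter is put in front of `w`. -/
def windowWeight [DecidableEq A] {M : ℕ} (u v : List A) (q : {l : List A // l.length ≤ M}) (a : A) :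
    ℤ :=
  (if u <+: a :: q.1 then 1 else 0) - if v <+: a :: q.1 then 1 else 0

theorem foldl_windowStep (M : ℕ) (w : List A) :
    (w.reverse.foldl (windowStep M) ⟨[], Nat.zero_le M⟩).1 = w.take M := by
  induction w with
  | nil => simp
  | cons a w ih =>
    rw [List.reverse_cons, List.foldl_append, List.foldl_cons, List.foldl_nil]
    change (a :: _).take M = _
    rw [ih]
    cases M with
    | zero => simp
    | succ M => simp [List.take_take]

theorem prefix_cons_take_iff {M : ℕ} {v : List A} (hv : v.length ≤ M) (a : A) (w : List A) :
    v <+: a :: w.take M ↔ v <+: a :: w := by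
  rw [← List.take_succ_cons, List.prefix_take_iff]
  exact and_iff_left (by omega)

/-- By `occ_cons`, a letter put in front creates an occurrence only at the start, and the first `M`
letters of the old word suffice to detect it. The reversal turns prepending into reading the next
letter. -/
theorem occ_sub_occ [DecidableEq A] {M : ℕ} {u v : List A} (hu : u.length ≤ M)
    (hv : v.length ≤ M) (w : List A) :
    (occ u w - occ v w : ℤ) = (occ u [] - occ v []) +
      runWeight (windowStep M) (windowWeight u v) ⟨[], Nat.zero_le M⟩ w.reverse := by
  induction w with
  | nil => simp [runWeight]
  | cons a w ih =>
    rw [List.reverse_cons, runWeight_append, ← add_assoc, ← ih, occ_cons, occ_cons]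
    simp only [runWeight, windowWeight, foldl_windowStep, prefix_cons_take_iff hu,
      prefix_cons_take_iff hv]
    push_cast
    ring

theorem abs_ite_sub_ite_le (p q : Prop) [Decidable p] [Decidable q] :
    |(if p then 1 else 0) - (if q then 1 else 0 : ℤ)| ≤ 1 := by
  split_ifs <;> simp

noncomputable instance fintypeWindow [Fintype A] (M : ℕ) :
    Fintype {l : List A // l.length ≤ M} :=
  (List.finite_length_le A M).fintype

/-- A window is determined by its `M` optional letters. -/
theorem card_window_le [Fintype A] (M : ℕ) :
    Fintype.card {l : List A // l.length ≤ M} ≤ (Fintype.card A + 1) ^ M := by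
  have h : Function.Injective
      fun (l : {l : List A // l.length ≤ M}) (i : Fin M) => l.1[(i : ℕ)]? := by
    rintro ⟨l, hl⟩ ⟨l', hl'⟩ h
    refine Subtype.ext (List.ext_getElem? fun i => ?_)
    by_cases hi : i < M
    · exact congrFun h ⟨i, hi⟩
    · rw [List.getElem?_eq_none (by simp only; omega),
        List.getElem?_eq_none (by simp only; omega)]
  have := Fintype.card_le_of_injective _ h
  simpa using this

end Window

/-! ### Pumping in Word-MIX languages -/

/-- A bound for the coordinates of the vectors in the pumping argument. -/
def weightBound (n : ℕ) (ws : List (List ℕ)) : ℕ :=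
  (n + 1) ^ ws.flatten.length * ((n + 1) ^ ws.flatten.length + 1) + 1

/-- Longer words of a Word-MIX language over `n` letters can be pumped. -/
def pumpingBound (n : ℕ) (ws : List (List ℕ)) : ℕ :=
  zeroSumStep^[ws.length] (weightBound n ws) + weightBound n ws

/-- The map `f` affects only the form of the bound, which depends on word lengths; it puts the bound
in terms of the encoded words given to the algorithm. -/
theorem wmix_pumping {A : Type u} [Fintype A] (ws : List (List A)) (f : A → ℕ) {w : List A}
    (hw : w ∈ wmix ws)
    (hlen : pumpingBound (Fintype.card A) (ws.map (List.map f)) < w.length) :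
    (∃ w' ∈ wmix ws, w'.length < w.length ∧
      w.length ≤ w'.length + pumpingBound (Fintype.card A) (ws.map (List.map f))) ∧
    ∃ w' ∈ wmix ws, w.length < w'.length := by
  classical
  -- The total length is a simple bound for the length of every parameter word.
  set M := ws.flatten.length with hM
  have hM' : (ws.map (List.map f)).flatten.length = M := by
    rw [← List.map_flatten, List.length_map]
  have hle : ∀ j, (ws.getD j []).length ≤ M := by
    intro j
    by_cases hj : j < ws.length
    · rw [List.getD_eq_getElem _ _ hj]
      exact (List.sublist_flatten_of_mem (List.getElem_mem hj)).length_le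
    · rw [List.getD_eq_default _ _ (not_lt.1 hj)]
      simp
  have hmem : ∀ w : List A, w ∈ wmix ws ↔ ∀ j < ws.length,
      (occ (ws.getD j []) [] - occ (ws.getD 0 []) [] : ℤ) +
        runWeight (windowStep M) (windowWeight (ws.getD j []) (ws.getD 0 [])) ⟨[], Nat.zero_le M⟩
          w.reverse = 0 := by
    intro w
    simp only [← occ_sub_occ (hle _) (hle _), sub_eq_zero, Nat.cast_inj]
    constructor
    · intro h j hj
      have h0 : 0 < ws.length := by omega
      rw [List.getD_eq_getElem _ _ hj, List.getD_eq_getElem _ _ h0]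
      exact h _ (List.getElem_mem hj) _ (List.getElem_mem h0)
    · have key : (∀ j < ws.length, occ (ws.getD j []) w = occ (ws.getD 0 []) w) →
          ∀ u ∈ ws, occ u w = occ (ws.getD 0 []) w := by
        intro h u hu
        obtain ⟨j, hj, rfl⟩ := List.getElem_of_mem hu
        rw [← List.getD_eq_getElem _ [] hj]
        exact h j hj
      exact fun h u hu v hv => (key h u hu).trans (key h v hv).symm
  rw [pumpingBound, List.length_map] at *
  have hcard := card_window_le (A := A) M
  obtain ⟨⟨x, hx, hx', hx''⟩, y, hy, hy'⟩ := exists_shorter_and_longer (windowStep M)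
    ⟨[], Nat.zero_le M⟩ ws.length (weightBound (Fintype.card A) (ws.map (List.map f)))
    (fun j => windowWeight (ws.getD j []) (ws.getD 0 []))
    (fun j => occ (ws.getD j []) [] - occ (ws.getD 0 []) [])
    (fun j q a => abs_ite_sub_ite_le _ _)
    (fun j => by
      rw [occ_nil, occ_nil]
      push_cast
      exact abs_ite_sub_ite_le _ _)
    (by
      rw [weightBound, hM']
      gcongr)
    w.reverse ((hmem w).1 hw) (by rwa [List.length_reverse])
  rw [List.length_reverse] at *
  refine ⟨⟨x.reverse, ?_, ?_, ?_⟩, y.reverse, ?_, ?_⟩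
  · rw [hmem, List.reverse_reverse]
    exact hx
  · rwa [List.length_reverse]
  · rw [List.length_reverse]
    omega
  · rw [hmem, List.reverse_reverse]
    exact hy
  · rwa [List.length_reverse]

theorem wmix_infinite_iff {A : Type u} [Fintype A] (ws : List (List A)) (f : A → ℕ) :
    (wmix ws).Infinite ↔ ∃ w ∈ wmix ws,
      pumpingBound (Fintype.card A) (ws.map (List.map f)) < w.length ∧
        w.length < 2 * pumpingBound (Fintype.card A) (ws.map (List.map f)) + 2 := by
  set N := pumpingBound (Fintype.card A) (ws.map (List.map f)) with hN
  constructor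
  · intro h
    have hex : ∃ m, ∃ w ∈ wmix ws, N < w.length ∧ w.length = m := by
      by_contra! hcon
      refine h ((List.finite_length_le A N).subset fun w hw => ?_)
      by_contra hlt
      exact hcon _ w hw (not_le.1 hlt) rfl
    classical
    obtain ⟨w, hw, hlt, hm⟩ := Nat.find_spec hex
    -- `w` is a shortest word longer than `N`. From length `2 * N + 2` on, losing at most `N`
    -- letters would leave a shorter such word.
    refine ⟨w, hw, hlt, ?_⟩
    by_contra! hge
    obtain ⟨⟨w', hw', h1, h2⟩, -⟩ := wmix_pumping ws f hw hlt
    exact Nat.find_min hex (hm ▸ h1) ⟨w', hw', by omega, rfl⟩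
  · rintro ⟨w, hw, hlt, -⟩ hfin
    obtain ⟨m, ⟨hm, hm'⟩, hmax⟩ := Set.exists_max_image {w ∈ wmix ws | N < w.length} List.length
      (hfin.subset (Set.sep_subset _ _)) ⟨w, hw, hlt⟩
    obtain ⟨-, w', hw', h1⟩ := wmix_pumping ws f hm hm'
    have := hmax w' ⟨hw', hm'.trans h1⟩
    omega

/-! ### The finite search on encoded words -/

/-- The number of occurrences of `v`, computed by recursion on the word. -/
def countOcc (v w : List ℕ) : ℕ :=
  List.rec (if v = [] then 1 else 0)
    (fun a w k => if v = (a :: w).take v.length then k + 1 else k) w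

theorem countOcc_cons (v w : List ℕ) (a : ℕ) :
    countOcc v (a :: w) = countOcc v w + if v <+: a :: w then 1 else 0 := by
  change (if v = (a :: w).take v.length then countOcc v w + 1 else countOcc v w) = _
  simp only [← List.prefix_iff_eq_take]
  split_ifs <;> rfl

theorem countOcc_map {A : Type*} (f : A → ℕ) (hf : Function.Injective f) (v w : List A) :
    countOcc (v.map f) (w.map f) = occ v w := by
  classical
  induction w with
  | nil =>
    rw [occ_nil]
    simp [countOcc]
  | cons a w ih =>
    rw [List.map_cons, countOcc_cons, ih, occ_cons, ← List.map_cons]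
    congr 1
    refine if_congr ?_ rfl rfl
    rw [List.prefix_map_iff_of_injective hf]

/-- The words of length `k` over the alphabet `{0, …, n - 1}`. -/
def wordsOfLength (n k : ℕ) : List (List ℕ) :=
  Nat.rec [[]] (fun _ L => L.flatMap fun w => (List.range n).map fun a => a :: w) k

theorem mem_wordsOfLength {n k : ℕ} {w : List ℕ} :
    w ∈ wordsOfLength n k ↔ w.length = k ∧ ∀ a ∈ w, a < n := by
  induction k generalizing w with
  | zero =>
    change w ∈ [[]] ↔ _
    simp only [List.mem_singleton, List.length_eq_zero_iff]
    constructor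
    · rintro rfl
      simp
    · exact And.left
  | succ k ih =>
    change w ∈ (wordsOfLength n k).flatMap (fun w => (List.range n).map fun a => a :: w) ↔ _
    simp only [List.mem_flatMap, List.mem_map, List.mem_range, ih]
    constructor
    · rintro ⟨v, ⟨rfl, hv⟩, a, ha, rfl⟩
      simpa using ⟨ha, hv⟩
    · rintro ⟨hl, hw⟩
      obtain ⟨a, v, rfl⟩ := List.exists_cons_of_length_eq_add_one hl
      simp only [List.mem_cons, forall_eq_or_imp] at hw
      exact ⟨v, ⟨by simpa using hl, hw.2⟩, a, hw.1, rfl⟩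

/-- The finite search that decides whether the Word-MIX language is infinite. -/
def LongWordExists (n : ℕ) (ws : List (List ℕ)) : Prop :=
  ∃ w ∈ (List.range (2 * pumpingBound n ws + 2)).flatMap (wordsOfLength n),
    pumpingBound n ws < w.length ∧ ∀ u ∈ ws, ∀ v ∈ ws, countOcc u w = countOcc v w

theorem longWordExists_iff {A : Type u} {n : ℕ} (e : A ≃ Fin n) (ws : List (List A)) :
    LongWordExists n (ws.map (List.map fun a => (e a : ℕ))) ↔ (wmix ws).Infinite := by
  let : Fintype A := Fintype.ofEquiv _ e.symm
  have hcard : Fintype.card A = n := by rw [Fintype.card_congr e, Fintype.card_fin]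
  have hinj : Function.Injective fun a => (e a : ℕ) :=
    fun a b h => e.injective (Fin.ext h)
  rw [wmix_infinite_iff ws fun a => (e a : ℕ), hcard, LongWordExists]
  set N := pumpingBound n (ws.map (List.map fun a => (e a : ℕ)))
  have hmem : ∀ w : List A, w ∈ wmix ws ↔ ∀ u ∈ ws.map (List.map fun a => (e a : ℕ)),
      ∀ v ∈ ws.map (List.map fun a => (e a : ℕ)),
        countOcc u (w.map fun a => (e a : ℕ)) = countOcc v (w.map fun a => (e a : ℕ)) := by
    intro w
    simp only [List.forall_mem_map, countOcc_map _ hinj]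
    rfl
  simp only [List.mem_flatMap, List.mem_range, mem_wordsOfLength]
  constructor
  · rintro ⟨w, ⟨k, hk, rfl, hw⟩, hlt, hocc⟩
    obtain ⟨w, rfl⟩ : ∃ v : List A, w = v.map fun a => (e a : ℕ) := by
      refine ⟨w.attach.map fun a => e.symm ⟨a.1, hw _ a.2⟩, ?_⟩
      rw [List.map_map]
      conv_lhs => rw [← List.attach_map_subtype_val w]
      refine List.map_congr_left fun a _ => ?_
      simp
    rw [List.length_map] at hk hlt
    exact ⟨w, (hmem w).2 hocc, hlt, hk⟩
  · rintro ⟨w, hw, hlt, hk⟩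
    refine ⟨w.map fun a => (e a : ℕ), ⟨w.length, hk, List.length_map _, ?_⟩, ?_, (hmem w).1 hw⟩
    · simp
    · rwa [List.length_map]

/-! ### Primitive recursiveness of the search -/

open Primrec in
theorem primrec_zeroSumStep : Primrec zeroSumStep := by
  have hc : Primrec fun B : ℕ => B * B * B + B * B + B :=
    nat_add.comp (nat_add.comp (nat_mul.comp (nat_mul.comp .id .id) .id) (nat_mul.comp .id .id)) .id
  exact nat_add.comp (nat_add.comp (nat_add.comp .id (nat_mul.comp hc .id))
    (nat_mul.comp (nat_add.comp (nat_mul.comp (.const 2) .id) (.const 1)) .id))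
    (nat_mul.comp hc .id)

open Primrec in
theorem primrec_pow : Primrec₂ fun a b : ℕ => a ^ b := by
  refine ((nat_rec (f := fun _ : ℕ => 1) (g := fun a (p : ℕ × ℕ) => p.2 * a) (.const 1)
    (nat_mul.comp (snd.comp snd) fst))).of_eq fun a b => ?_
  induction b with
  | zero => rfl
  | succ b ih => exact (congrArg (· * a) ih).trans (pow_succ a b).symm

open Primrec in
theorem primrec_pumpingBound : Primrec₂ pumpingBound := by
  have hp : Primrec fun p : ℕ × List (List ℕ) => (p.1 + 1) ^ p.2.flatten.length :=
    primrec_pow.comp (succ.comp fst) (list_length.comp (list_flatten.comp snd))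
  have hb : Primrec fun p : ℕ × List (List ℕ) => weightBound p.1 p.2 :=
    succ.comp (nat_mul.comp hp (succ.comp hp))
  exact nat_add.comp (nat_iterate (list_length.comp snd) hb (primrec_zeroSumStep.comp snd).to₂) hb

open Primrec in
theorem primrec_countOcc : Primrec₂ countOcc := by
  refine (list_rec (f := fun p : List ℕ × List ℕ => p.2)
    (g := fun p => if p.1 = [] then 1 else 0)
    (h := fun p (q : ℕ × List ℕ × ℕ) =>
      if p.1 = (q.1 :: q.2.1).take p.1.length then q.2.2 + 1 else q.2.2)
    snd (Primrec.ite (Primrec.eq.comp fst (.const [])) (.const 1) (.const 0)) ?_).of_eq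
    fun p => rfl
  refine Primrec.ite (Primrec.eq.comp (fst.comp fst) (list_take.comp
    (list_length.comp (fst.comp fst)) (list_cons.comp (fst.comp snd) (fst.comp (snd.comp snd)))))
    (succ.comp (snd.comp (snd.comp snd))) (snd.comp (snd.comp snd))

open Primrec in
theorem primrec_wordsOfLength : Primrec₂ wordsOfLength := by
  refine nat_rec (f := fun _ : ℕ => [[]]) (g := fun n (p : ℕ × List (List ℕ)) =>
    p.2.flatMap fun w => (List.range n).map fun a => a :: w) (.const _) ?_
  refine list_flatMap (snd.comp snd) (list_map (list_range.comp (fst.comp fst)) ?_)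
  exact list_cons.comp snd (snd.comp fst)

open Primrec in
theorem primrec_longWordExists : PrimrecRel LongWordExists := by
  have hb : Primrec fun p : ℕ × List (List ℕ) => pumpingBound p.1 p.2 := primrec_pumpingBound
  have hlist : Primrec fun p : ℕ × List (List ℕ) =>
      (List.range (2 * pumpingBound p.1 p.2 + 2)).flatMap (wordsOfLength p.1) :=
    list_flatMap (list_range.comp (nat_add.comp (nat_mul.comp (.const 2) hb) (.const 2)))
      (primrec_wordsOfLength.comp (fst.comp fst) snd)
  have heq : PrimrecRel fun (v : List ℕ) (q : List ℕ × List ℕ) =>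
      countOcc q.1 q.2 = countOcc v q.2 :=
    Primrec.eq.comp (primrec_countOcc.comp (fst.comp snd) (snd.comp snd))
      (primrec_countOcc.comp fst (snd.comp snd))
  have hinner : PrimrecRel fun (u : List ℕ) (q : List (List ℕ) × List ℕ) =>
      ∀ v ∈ q.1, countOcc u q.2 = countOcc v q.2 :=
    heq.forall_mem_list.comp (fst.comp snd) (.pair fst (snd.comp snd))
  have houter : PrimrecRel fun (w : List ℕ) (p : ℕ × List (List ℕ)) =>
      pumpingBound p.1 p.2 < w.length ∧ ∀ u ∈ p.2, ∀ v ∈ p.2, countOcc u w = countOcc v w :=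
    (nat_lt.comp (hb.comp snd) (list_length.comp fst)).and
      (hinner.forall_mem_list.comp (snd.comp snd) (.pair (snd.comp snd) fst))
  exact houter.exists_mem_list.comp hlist .id

/-- A single algorithm takes the size `n` of the alphabet and the list of parameter words, with
letters written as their indices below `n` under an enumeration `e` of the alphabet, and decides
whether the Word-MIX language is infinite. -/
theorem corollary1 :
    ∃ isInfinite : ℕ → List (List ℕ) → Bool, Computable₂ isInfinite ∧
      ∀ (A : Type u) (n : ℕ) (e : A ≃ Fin n) (ws : List (List A)),
        isInfinite n (ws.map (List.map fun a => (e a : ℕ))) = true ↔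
          (wmix ws).Infinite := by
  obtain ⟨hdec, hprim⟩ := primrec_longWordExists
  -- The decision procedure must use the instance `hdec`, since `hprim` speaks of that instance.
  refine ⟨fun n ws => @decide (LongWordExists n ws) (hdec (n, ws)), hprim.to_comp, fun A n e ws => ?_⟩
  exact (@decide_eq_true_iff (LongWordExists _ _) (hdec (_, _))).trans (longWordExists_iff e ws)
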